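/- **Setting.** There are $n$ forecasters and $m\ge 1$ independent binary events with true probabilities $\theta\in[0,1]^m$; forecaster $i$ has beliefs $p_i\in[0,1]^m$ (forming a matrix $P$) and makes reports $r_i\in[0,1]^m$ (forming a matrix $R$). For outcomes $y\in\{0,1\}^m$, a mechanism $M$ selects forecaster $i$ with probability $M(R,y)_i$. For a belief $p_i$, a report $r_i$ is *undominated* if there is no report $\hat r_i$ with $\mathbb E_{y\sim p_i}M(\hat r_i,R_{-i},y)_i>\mathbb E_{y\sim p_i}M(r_i,R_{-i},y)_i$ for all $R_{-i}$. The accuracy of $i$ is $a_i=1-\frac1m\sum_{t}(p_{it}-\theta_t)^2$, and $i$ is $\epsilon$-optimal if $a_i\ge\max_j a_j-\epsilon$. The mechanism $M$ is $(\epsilon,\delta)$-accurate in the setting $(n,m,P,\theta)$ if, for every $R$ whose rows $r_i$ are undominated for the beliefs $p_i$, the forecaster selected is $\epsilon$-optimal with probability at least $1-\delta$ over $y\sim\theta$ and $i\sim M(R,y)$. The *event complexity* $m^*(n,\epsilon,\delta)$ of $M$ is the smallest integer $m\ge1$ such that $M$ is $(\epsilon,\delta)$-accurate in the setting $(n,m,P,\theta)$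 for all $P$ and $\theta$ (and $m^*=\infty$ if there is no such $m$). The mechanism *ELF* awards, independently for each event $t$, one point to a single forecaster, who is $i$ with probability $$\frac1n+\frac1n\Big(S(r_{it},y_t)-\frac{\sum_{j\ne i}S(r_{jt},y_t)}{n-1}\Big),\qquad S(q,y)=1-(y-q)^2,$$ and then selects a forecaster with the most points, breaking ties uniformly at random. (For $n=1$ it selects the only forecaster.) **Theorem.** For all real $\delta<\frac12$ and $\epsilon<1$ and all sufficiently large $n$ (depending on $\delta,\epsilon$), the event complexity of ELF satisfies $$m^*(n,\epsilon,\delta)>\frac n4\log n .$$ Moreover, for every such $n$ and every integer $m$ with $1\le m\le\frac n4\log n$, ELF is not $(\epsilon,\delta)$-accurate in the setting $(n,m,P,\theta)$ with $\theta=p_1=(1,\dots,1)$ and $p_j=(0,\dots,0)$ for all $j\ne1$. -/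

import Mathlib

open Filter
open scoped BigOperators

noncomputable section

namespace ForecastingCompetition

/-- Report (or belief) matrices of `n` forecasters on `m` binary events. -/
abbrev Reports (n m : ℕ) : Type := Fin n → Fin m → unitInterval

/-- Outcome vectors in `{0,1}^m`; `true` is the outcome `1`. -/
abbrev Outcomes (m : ℕ) : Type := Fin m → Bool

/-- The numerical value of an outcome. -/
def outcomeValue (b : Bool) : ℝ := if b then 1 else 0

/-- The probability of the outcome vector `y` when the events are independent and event `t`
has probability `q t`. -/
def outcomeProb {m : ℕ} (q : Fin m → unitInterval) (y : Outcomes m) : ℝ :=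
  ∏ t, if y t then (q t : ℝ) else 1 - (q t : ℝ)

/-- A forecasting competition mechanism: `prob n m R y i` is the probability with which
forecaster `i` is selected on reports `R` and outcomes `y`. (The simplex over zero forecasters
is empty, so `n = 0` carries no condition.) -/
structure Mechanism where
  prob : ∀ n m : ℕ, Reports n m → Outcomes m → Fin n → ℝ
  mem_stdSimplex : ∀ (n m : ℕ) (R : Reports n m) (y : Outcomes m), 0 < n →
    prob n m R y ∈ stdSimplex ℝ (Fin n)

/-- Forecaster `i`'s accuracy `1 - (1/m) ∑ₜ (p_{it} - θₜ)²` (meaningful for `0 < m`). -/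
def accuracy {n m : ℕ} (P : Reports n m) (θ : Fin m → unitInterval) (i : Fin n) : ℝ :=
  1 - (1 / (m : ℝ)) * ∑ t, ((P i t : ℝ) - (θ t : ℝ)) ^ 2

/-- Forecaster `i` is `ε`-optimal: her accuracy is at least the maximal accuracy minus `ε`. -/
def IsOptimal {n m : ℕ} (ε : ℝ) (P : Reports n m) (θ : Fin m → unitInterval) (i : Fin n) : Prop :=
  ∀ j, accuracy P θ j - ε ≤ accuracy P θ i

namespace Mechanism

/-- The expected probability, over `y ∼ p`, that forecaster `i` is selected on reports `R`. -/
def utility (M : Mechanism) {n m : ℕ} (R : Reports n m) (p : Fin m → unitInterval)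
    (i : Fin n) : ℝ :=
  ∑ y : Outcomes m, outcomeProb p y * M.prob n m R y i

/-- For forecaster `i` with belief `p`, the report `r'` strictly dominates the report `r`:
it is strictly better whatever the others report. (Row `i` of `R` is overwritten.) -/
def StrictlyDominates (M : Mechanism) {n m : ℕ} (i : Fin n) (p r' r : Fin m → unitInterval) :
    Prop :=
  ∀ R : Reports n m,
    M.utility (Function.update R i r) p i < M.utility (Function.update R i r') p i

/-- The report `r` of forecaster `i` with belief `p` is undominated. -/
def Undominated (M : Mechanism) {n m : ℕ} (i : Fin n) (p r : Fin m → unitInterval) : Prop :=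
  ¬ ∃ r' : Fin m → unitInterval, M.StrictlyDominates i p r' r

open Classical in
/-- The probability, over `y ∼ θ` and `i ∼ M(R, y)`, that the selected forecaster `i` is
`ε`-optimal for the beliefs `P`. -/
def successProb (M : Mechanism) {n m : ℕ} (ε : ℝ) (P : Reports n m) (θ : Fin m → unitInterval)
    (R : Reports n m) : ℝ :=
  ∑ y : Outcomes m, outcomeProb θ y *
    ∑ i, if IsOptimal ε P θ i then M.prob n m R y i else 0

/-- `M` is `(ε, δ)`-accurate in the setting `(n, m, P, θ)`. -/
def IsAccurate (M : Mechanism) {n m : ℕ} (ε δ : ℝ) (P : Reports n m)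
    (θ : Fin m → unitInterval) : Prop :=
  ∀ R : Reports n m, (∀ i, M.Undominated i (P i) (R i)) → 1 - δ ≤ M.successProb ε P θ R

/-- The event complexity: the smallest number `m ≥ 1` of events such that `M` is
`(ε, δ)`-accurate in the setting `(n, m, P, θ)` for all `P` and `θ`, and `⊤` if there is none. -/
def eventComplexity (M : Mechanism) (n : ℕ) (ε δ : ℝ) : ℕ∞ :=
  ⨅ (m : ℕ) (_ : 0 < m ∧
    ∀ (P : Reports n m) (θ : Fin m → unitInterval), M.IsAccurate ε δ P θ), (m : ℕ∞)

end Mechanism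

/-- The quadratic scoring rule. -/
def quadScore (q : unitInterval) (b : Bool) : ℝ := 1 - (outcomeValue b - (q : ℝ)) ^ 2

/-- The probability that forecaster `i` wins the point for event `t` in the ELF mechanism.
A single forecaster (for whom the average over the others is undefined) wins every point. -/
def elfPointProb {n m : ℕ} (R : Reports n m) (y : Outcomes m) (t : Fin m) (i : Fin n) : ℝ :=
  if n = 1 then 1 else
    1 / (n : ℝ) + 1 / (n : ℝ) * (quadScore (R i t) (y t) -
      (∑ j ∈ Finset.univ.erase i, quadScore (R j t) (y t)) / ((n : ℝ) - 1))

/-- The number of points of forecaster `i`, if `w t` is the winner of the point for event `t`. -/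
def points {n m : ℕ} (w : Fin m → Fin n) (i : Fin n) : ℕ :=
  (Finset.univ.filter fun t => w t = i).card

/-- The forecasters with the most points. -/
def leaders {n m : ℕ} (w : Fin m → Fin n) : Finset (Fin n) :=
  Finset.univ.filter fun i => ∀ j, points w j ≤ points w i

/-- The selection probabilities of ELF: the points are awarded by independent lotteries, one per
event, and the winner is uniform among the forecasters with the most points. -/
def elfProb (n m : ℕ) (R : Reports n m) (y : Outcomes m) (i : Fin n) : ℝ :=
  ∑ w : Fin m → Fin n, (∏ t, elfPointProb R y t (w t)) *
    (if i ∈ leaders w then 1 / ((leaders w).card : ℝ) else 0)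

theorem quadScore_mem (q : unitInterval) (b : Bool) : 0 ≤ quadScore q b ∧ quadScore q b ≤ 1 := by
  have h0 := q.2.1
  have h1 := q.2.2
  cases b
  · have h : quadScore q false = 1 - (q : ℝ) ^ 2 := by simp [quadScore, outcomeValue]
    rw [h]
    constructor <;> nlinarith
  · have h : quadScore q true = 1 - (1 - (q : ℝ)) ^ 2 := by simp [quadScore, outcomeValue]
    rw [h]
    constructor <;> nlinarith

theorem elfPointProb_nonneg {n m : ℕ} (R : Reports n m) (y : Outcomes m) (t : Fin m)
    (i : Fin n) : 0 ≤ elfPointProb R y t i := by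
  unfold elfPointProb
  split_ifs with h
  · exact zero_le_one
  · have hn : 0 < n := i.pos
    have hn2 : (2 : ℝ) ≤ n := by exact_mod_cast (by omega : 2 ≤ n)
    have hsum : ∑ j ∈ Finset.univ.erase i, quadScore (R j t) (y t) ≤ (n : ℝ) - 1 := by
      calc ∑ j ∈ Finset.univ.erase i, quadScore (R j t) (y t)
          ≤ ∑ j ∈ Finset.univ.erase i, (1 : ℝ) :=
            Finset.sum_le_sum fun j _ => (quadScore_mem _ _).2
        _ = (n : ℝ) - 1 := by
            simp [Finset.card_erase_of_mem, Nat.cast_sub (by omega : 1 ≤ n)]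
    have hdiv : (∑ j ∈ Finset.univ.erase i, quadScore (R j t) (y t)) / ((n : ℝ) - 1) ≤ 1 :=
      (div_le_one (by linarith)).2 hsum
    have h0 := (quadScore_mem (R i t) (y t)).1
    have hinv : (0 : ℝ) ≤ 1 / n := by positivity
    nlinarith

theorem sum_elfPointProb {n m : ℕ} (hn : 0 < n) (R : Reports n m) (y : Outcomes m)
    (t : Fin m) : ∑ i, elfPointProb R y t i = 1 := by
  unfold elfPointProb
  split_ifs with h
  · simp [h]
  · have hn2 : (2 : ℝ) ≤ n := by exact_mod_cast (by omega : 2 ≤ n)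
    have he : ∀ i : Fin n, ∑ j ∈ Finset.univ.erase i, quadScore (R j t) (y t) =
        (∑ j, quadScore (R j t) (y t)) - quadScore (R i t) (y t) := fun i => by
      rw [← Finset.add_sum_erase Finset.univ _ (Finset.mem_univ i)]; ring
    simp only [he]
    rw [Finset.sum_add_distrib, ← Finset.mul_sum, Finset.sum_sub_distrib,
      ← Finset.sum_div Finset.univ
        (fun i => (∑ j, quadScore (R j t) (y t)) - quadScore (R i t) (y t)),
      Finset.sum_sub_distrib]
    simp only [Finset.sum_const, Finset.card_univ, Fintype.card_fin, nsmul_eq_mul]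
    have h1 : (n : ℝ) ≠ 0 := by linarith
    have h2 : (n : ℝ) - 1 ≠ 0 := by linarith
    field_simp
    ring

theorem leaders_nonempty {n m : ℕ} (hn : 0 < n) (w : Fin m → Fin n) : (leaders w).Nonempty := by
  obtain ⟨i, -, hi⟩ := Finset.exists_max_image Finset.univ (points w) ⟨⟨0, hn⟩, Finset.mem_univ _⟩
  exact ⟨i, by simpa [leaders] using hi⟩

theorem elfProb_mem_stdSimplex (n m : ℕ) (R : Reports n m) (y : Outcomes m) (hn : 0 < n) :
    elfProb n m R y ∈ stdSimplex ℝ (Fin n) := by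
  refine ⟨fun i => Finset.sum_nonneg fun w _ => mul_nonneg
    (Finset.prod_nonneg fun t _ => elfPointProb_nonneg R y t _) (by positivity), ?_⟩
  unfold elfProb
  rw [Finset.sum_comm]
  have hw : ∀ w : Fin m → Fin n,
      ∑ i, (if i ∈ leaders w then 1 / ((leaders w).card : ℝ) else 0) = 1 := fun w => by
    have hc : ((leaders w).card : ℝ) ≠ 0 := by
      exact_mod_cast (Finset.card_pos.2 (leaders_nonempty hn w)).ne'
    rw [Finset.sum_ite_mem, Finset.univ_inter, Finset.sum_const, nsmul_eq_mul,
      mul_one_div_cancel hc]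
  simp only [← Finset.mul_sum, hw, mul_one]
  rw [← Fintype.prod_sum]
  exact Finset.prod_eq_one fun t _ => sum_elfPointProb hn R y t

/-- The ELF (Event Lotteries Forecast) mechanism. -/
def elf : Mechanism where
  prob := elfProb
  mem_stdSimplex := elfProb_mem_stdSimplex

/-- The beliefs in which the first forecaster says `1` on every event and all others say `0`. -/
def onePerfectBeliefs (n m : ℕ) : Reports n m := fun i _ => if i.val = 0 then 1 else 0

end ForecastingCompetition

end

namespace ForecastingCompetition

open Finset

/-! Under the stated beliefs and truthful reports every outcome is `1`, and the perfect forecaster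
wins each point with probability only `2/n`: a slight tilt of the uniform lottery. Under the uniform
lottery symmetry selects everyone with probability `1/n`. Cauchy–Schwarz transfers this to the
tilted lottery `q` (`sq_sum_prod_mul_tieBreak_le`): the squared selection probability is at most `(n
∑ q²)^m / n = (n/(n-1))^m / n`. For `m ≤ (n/4) log n` this is at most `n^(-1/2)`, so at most `1/4`
once `n ≥ 16`. Truthful reports are undominated because selection is monotone in the scores
(`elfProb_update_le`), and a forecaster certain of the outcomes already has the maximal score on
each event. -/

/-! ### Symmetry of tie-breaking and the second-moment bound -/

/-- The probability that `i` is selected when `w t` is the winner of the point for event `t`. -/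
noncomputable def tieBreak {n m : ℕ} (w : Fin m → Fin n) (i : Fin n) : ℝ :=
  if i ∈ leaders w then 1 / ((leaders w).card : ℝ) else 0

theorem tieBreak_nonneg {n m : ℕ} (w : Fin m → Fin n) (i : Fin n) : 0 ≤ tieBreak w i := by
  unfold tieBreak
  positivity

theorem tieBreak_le_one {n m : ℕ} (w : Fin m → Fin n) (i : Fin n) : tieBreak w i ≤ 1 := by
  unfold tieBreak
  split_ifs with h
  · have hc : (1 : ℝ) ≤ (leaders w).card := by exact_mod_cast Finset.card_pos.2 ⟨i, h⟩
    exact (div_le_one (by linarith)).2 hc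
  · exact zero_le_one

theorem sum_tieBreak {n m : ℕ} (hn : 0 < n) (w : Fin m → Fin n) : ∑ i, tieBreak w i = 1 := by
  have hc : ((leaders w).card : ℝ) ≠ 0 := by
    exact_mod_cast (Finset.card_pos.2 (leaders_nonempty hn w)).ne'
  unfold tieBreak
  rw [Finset.sum_ite_mem, Finset.univ_inter, Finset.sum_const, nsmul_eq_mul,
    mul_one_div_cancel hc]

theorem elfProb_eq_sum {n m : ℕ} (R : Reports n m) (y : Outcomes m) (i : Fin n) :
    elfProb n m R y i = ∑ w : Fin m → Fin n, (∏ t, elfPointProb R y t (w t)) * tieBreak w i :=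
  rfl

theorem points_comp_perm {n m : ℕ} (σ : Equiv.Perm (Fin n)) (w : Fin m → Fin n) (i : Fin n) :
    points (σ ∘ w) (σ i) = points w i := by
  simp [points]

theorem leaders_comp_perm {n m : ℕ} (σ : Equiv.Perm (Fin n)) (w : Fin m → Fin n) :
    leaders (σ ∘ w) = (leaders w).map σ.toEmbedding := by
  ext i
  obtain ⟨i, rfl⟩ := σ.surjective i
  simp [leaders, points_comp_perm, ← σ.forall_congr_right (q := fun j => points (σ ∘ w) j ≤ _)]

theorem tieBreak_comp_perm {n m : ℕ} (σ : Equiv.Perm (Fin n)) (w : Fin m → Fin n) (i : Fin n) :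
    tieBreak (σ ∘ w) (σ i) = tieBreak w i := by
  simp [tieBreak, leaders_comp_perm]

/-- If all points are awarded uniformly at random, every forecaster is equally likely to win. -/
theorem card_mul_sum_tieBreak {n m : ℕ} (i : Fin n) :
    (n : ℝ) * ∑ w : Fin m → Fin n, tieBreak w i = (n : ℝ) ^ m := by
  have hsymm : ∀ j : Fin n,
      ∑ w : Fin m → Fin n, tieBreak w j = ∑ w : Fin m → Fin n, tieBreak w i := fun j => by
    rw [← (Equiv.arrowCongr (Equiv.refl (Fin m)) (Equiv.swap j i)).sum_comp]
    refine Finset.sum_congr rfl fun w _ => ?_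
    have h := tieBreak_comp_perm (Equiv.swap j i) w i
    rw [Equiv.swap_apply_right] at h
    exact h
  calc (n : ℝ) * ∑ w : Fin m → Fin n, tieBreak w i
      = ∑ j : Fin n, ∑ w : Fin m → Fin n, tieBreak w j := by simp [hsymm]
    _ = ∑ w : Fin m → Fin n, ∑ j : Fin n, tieBreak w j := Finset.sum_comm
    _ = (n : ℝ) ^ m := by simp [sum_tieBreak i.pos]

/-- Cauchy–Schwarz bound on the probability that `i` is selected, if the points are awarded
independently according to `q`. -/
theorem sq_sum_prod_mul_tieBreak_le {n m : ℕ} (q : Fin n → ℝ) (i : Fin n) :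
    (∑ w : Fin m → Fin n, (∏ t, q (w t)) * tieBreak w i) ^ 2 ≤
      (n * ∑ k, q k ^ 2) ^ m / n := by
  have hn : (0 : ℝ) < n := by exact_mod_cast i.pos
  have hq : ∑ w : Fin m → Fin n, (∏ t, q (w t)) ^ 2 = (∑ k, q k ^ 2) ^ m := by
    simp only [← Finset.prod_pow]
    rw [← Fintype.prod_sum (fun (_ : Fin m) k => q k ^ 2)]
    simp
  have ht : ∑ w : Fin m → Fin n, tieBreak w i ^ 2 ≤ (n : ℝ) ^ m / n := by
    rw [← card_mul_sum_tieBreak (m := m) i, mul_div_cancel_left₀ _ hn.ne']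
    -- Tie-breaking weights lie in `[0,1]`, so squaring only lowers them.
    exact Finset.sum_le_sum fun w _ =>
      pow_le_of_le_one (tieBreak_nonneg w i) (tieBreak_le_one w i) two_ne_zero
  calc (∑ w : Fin m → Fin n, (∏ t, q (w t)) * tieBreak w i) ^ 2
      ≤ (∑ w : Fin m → Fin n, (∏ t, q (w t)) ^ 2) * ∑ w : Fin m → Fin n, tieBreak w i ^ 2 :=
        Finset.sum_mul_sq_le_sq_mul_sq _ _ _
    _ ≤ (∑ k, q k ^ 2) ^ m * ((n : ℝ) ^ m / n) := by
        rw [hq]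
        exact mul_le_mul_of_nonneg_left ht (by positivity)
    _ = (n * ∑ k, q k ^ 2) ^ m / n := by rw [mul_pow]; ring

/-! ### Monotonicity of selection in the scores -/

/-- Winning a point instead of another forecaster does not lower the chance of selection. -/
theorem tieBreak_update_le {n m : ℕ} (w : Fin m → Fin n) (t : Fin m) (i k : Fin n) :
    tieBreak (Function.update w t k) i ≤ tieBreak (Function.update w t i) i := by
  rcases eq_or_ne k i with rfl | hk
  · exact le_rfl
  by_cases hi : i ∈ leaders (Function.update w t k)
  · have hlt : points (Function.update w t k) i < points (Function.update w t i) i := by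
      refine Finset.card_lt_card (Finset.ssubset_iff_of_subset ?_ |>.2 ⟨t, by simp, by simp [hk]⟩)
      intro s hs
      rcases eq_or_ne s t with rfl | hst
      · simp
      · simpa [hst] using hs
    have hle : ∀ j, j ≠ i →
        points (Function.update w t i) j ≤ points (Function.update w t k) j := fun j hj => by
      refine Finset.card_le_card fun s hs => ?_
      rcases eq_or_ne s t with rfl | hst
      · simp [hj.symm] at hs
      · simpa [hst] using hs
    simp only [leaders, Finset.mem_filter, Finset.mem_univ, true_and] at hi
    -- A leader who gains a further point while nobody else gains becomes the sole leader.
    have hlead : leaders (Function.update w t i) = {i} := by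
      ext j
      simp only [leaders, Finset.mem_filter, Finset.mem_univ, true_and, Finset.mem_singleton]
      constructor
      · intro h
        by_contra hj
        have := h i
        have := hle j hj
        have := hi j
        omega
      · rintro rfl l
        rcases eq_or_ne l j with rfl | hl
        · exact le_rfl
        · have := hle l hl
          have := hi l
          omega
    have h1 : tieBreak (Function.update w t i) i = 1 := by simp [tieBreak, hlead]
    rw [h1]
    exact tieBreak_le_one _ _
  · have h0 : tieBreak (Function.update w t k) i = 0 := by simp [tieBreak, hi]
    rw [h0]
    exact tieBreak_nonneg _ _

/-- Exchanging the value at `t` with a spare value is an involution. This isolates the lottery of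
one event while the others stay fixed. -/
theorem sum_pi_eq_sum_sum_update {n m : ℕ} (t : Fin m) (F : (Fin m → Fin n) → ℝ) :
    (n : ℝ) * ∑ w, F w = ∑ w, ∑ k, F (Function.update w t k) := by
  let e : (Fin m → Fin n) × Fin n ≃ (Fin m → Fin n) × Fin n :=
    { toFun := fun x => (Function.update x.1 t x.2, x.1 t)
      invFun := fun x => (Function.update x.1 t x.2, x.1 t)
      left_inv := fun x => by simp
      right_inv := fun x => by simp }
  calc (n : ℝ) * ∑ w, F w = ∑ w : Fin m → Fin n, ∑ _k : Fin n, F w := by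
        simp [Finset.mul_sum]
    _ = ∑ x : (Fin m → Fin n) × Fin n, F x.1 :=
        (Fintype.sum_prod_type fun x : (Fin m → Fin n) × Fin n => F x.1).symm
    _ = ∑ x, F (e x).1 := (e.sum_comp fun x => F x.1).symm
    _ = ∑ w, ∑ k, F (Function.update w t k) := Fintype.sum_prod_type _

/-- Raising `i`'s chance for the point of one event, at the expense of all others, does not lower
the chance that `i` is selected. -/
theorem sum_prod_update_mul_tieBreak_le {n m : ℕ} (i : Fin n) (q : Fin m → Fin n → ℝ)
    (hq : ∀ t k, 0 ≤ q t k) (t : Fin m) (a b : Fin n → ℝ) (hab : ∑ k, a k = ∑ k, b k)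
    (hle : ∀ k, k ≠ i → b k ≤ a k) :
    ∑ w : Fin m → Fin n, (∏ s, Function.update q t a s (w s)) * tieBreak w i ≤
      ∑ w : Fin m → Fin n, (∏ s, Function.update q t b s (w s)) * tieBreak w i := by
  have hn : (0 : ℝ) < n := by exact_mod_cast i.pos
  refine le_of_mul_le_mul_left ?_ hn
  rw [sum_pi_eq_sum_sum_update t, sum_pi_eq_sum_sum_update t]
  refine Finset.sum_le_sum fun w _ => ?_
  have hprod : ∀ (c : Fin n → ℝ) (k : Fin n),
      ∏ s, Function.update q t c s (Function.update w t k s) =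
        c k * ∏ s ∈ univ.erase t, q s (w s) := fun c k => by
    rw [← Finset.mul_prod_erase univ _ (Finset.mem_univ t)]
    congr 1
    · simp
    · exact Finset.prod_congr rfl fun s hs => by simp [Finset.ne_of_mem_erase hs]
  simp only [hprod]
  set C := ∏ s ∈ univ.erase t, q s (w s)
  have hC : 0 ≤ C := Finset.prod_nonneg fun s _ => hq _ _
  -- Since `a` and `b` have equal mass, every weight may be compared with its value when `i` wins
  -- event `t`; the inequality then holds term by term, both factors having a sign for `k ≠ i`.
  have hsum : ∑ k, (b k - a k) * (C * tieBreak (Function.update w t i) i) = 0 := by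
    rw [← Finset.sum_mul, Finset.sum_sub_distrib, hab, sub_self, zero_mul]
  rw [← sub_nonneg, ← Finset.sum_sub_distrib, ← hsum]
  refine Finset.sum_le_sum fun k _ => ?_
  rcases eq_or_ne k i with rfl | hk
  · exact le_of_eq (by ring)
  · have h1 := mul_le_mul_of_nonneg_left (tieBreak_update_le w t i k) hC
    have h2 := hle k hk
    nlinarith

/-- Hybrid argument: the lotteries are replaced one event at a time, with `T` the set of events
already replaced. -/
theorem sum_prod_mul_tieBreak_le {n m : ℕ} (i : Fin n) (q q' : Fin m → Fin n → ℝ)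
    (hq : ∀ t k, 0 ≤ q t k) (hq' : ∀ t k, 0 ≤ q' t k) (hsum : ∀ t, ∑ k, q t k = ∑ k, q' t k)
    (hle : ∀ t k, k ≠ i → q' t k ≤ q t k) :
    ∑ w : Fin m → Fin n, (∏ t, q t (w t)) * tieBreak w i ≤
      ∑ w : Fin m → Fin n, (∏ t, q' t (w t)) * tieBreak w i := by
  have key : ∀ T : Finset (Fin m),
      ∑ w : Fin m → Fin n, (∏ t, q t (w t)) * tieBreak w i ≤
        ∑ w : Fin m → Fin n, (∏ t, T.piecewise q' q t (w t)) * tieBreak w i := by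
    intro T
    induction T using Finset.induction_on with
    | empty => simp
    | insert t T ht ih =>
      refine ih.trans ?_
      rw [Finset.piecewise_insert]
      have h := sum_prod_update_mul_tieBreak_le i (T.piecewise q' q) (fun s k => ?_) t (q t) (q' t)
        (hsum t) (hle t)
      · have hT : Function.update (T.piecewise q' q) t (q t) = T.piecewise q' q := by
          rw [Function.update_eq_self_iff, Finset.piecewise_eq_of_notMem _ _ _ ht]
        rwa [hT] at h
      · by_cases hs : s ∈ T
        · simpa [hs] using hq' s k
        · simpa [hs] using hq s k
  simpa using key univ

/-- A report that scores at least as well on every event gives at least the same chance of being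
selected by ELF. -/
theorem elfProb_update_le {n m : ℕ} (R : Reports n m) (y : Outcomes m) (i : Fin n)
    (r p : Fin m → unitInterval) (h : ∀ t, quadScore (r t) (y t) ≤ quadScore (p t) (y t)) :
    elfProb n m (Function.update R i r) y i ≤ elfProb n m (Function.update R i p) y i := by
  rw [elfProb_eq_sum, elfProb_eq_sum]
  refine sum_prod_mul_tieBreak_le i _ _ (fun t k => elfPointProb_nonneg _ _ _ _)
    (fun t k => elfPointProb_nonneg _ _ _ _)
    (fun t => by rw [sum_elfPointProb i.pos, sum_elfPointProb i.pos]) fun t k hk => ?_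
  unfold elfPointProb
  split_ifs with hn1
  · exact le_rfl
  · have hn : (0 : ℝ) ≤ (n : ℝ) - 1 := by
      have : (1 : ℝ) ≤ n := by exact_mod_cast i.pos
      linarith
    simp only [Function.update_of_ne hk]
    gcongr with j hj
    -- A rival's point probability changes only through `i`'s score in the subtracted average.
    rcases eq_or_ne j i with rfl | hji
    · simpa using h t
    · simp [hji]

/-! ### Certain beliefs and undominated truthful reports -/

/-- The report that is certain of the outcome `b` on every event. -/
def sureReport (m : ℕ) (b : Bool) : Fin m → unitInterval := fun _ => if b then 1 else 0

theorem outcomeProb_sureReport {m : ℕ} (b : Bool) (y : Outcomes m) :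
    outcomeProb (sureReport m b) y = if y = fun _ => b then 1 else 0 := by
  split_ifs with h
  · subst h
    cases b <;> simp [outcomeProb, sureReport]
  · obtain ⟨t, ht⟩ := Function.ne_iff.1 h
    refine Finset.prod_eq_zero (Finset.mem_univ t) ?_
    cases b <;> simp_all [sureReport]

theorem quadScore_le_sureReport {m : ℕ} (q : unitInterval) (b : Bool) (t : Fin m) :
    quadScore q b ≤ quadScore (sureReport m b t) b := by
  refine (quadScore_mem q b).2.trans (le_of_eq ?_)
  cases b <;> simp [quadScore, sureReport, outcomeValue]

theorem utility_sureReport (M : Mechanism) {n m : ℕ} (R : Reports n m) (b : Bool) (i : Fin n) :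
    M.utility R (sureReport m b) i = M.prob n m R (fun _ => b) i := by
  simp [Mechanism.utility, outcomeProb_sureReport]

theorem elf_undominated_sureReport {n m : ℕ} (i : Fin n) (b : Bool) :
    elf.Undominated i (sureReport m b) (sureReport m b) := by
  rintro ⟨r, hr⟩
  have h := hr fun _ _ => 0
  rw [utility_sureReport, utility_sureReport] at h
  exact h.not_ge (elfProb_update_le _ _ _ _ _ fun t => quadScore_le_sureReport _ b t)

/-! ### The setting with one perfect forecaster -/

theorem onePerfectBeliefs_eq_sureReport {n m : ℕ} (i : Fin n) :
    onePerfectBeliefs n m i = sureReport m (decide (i.val = 0)) := by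
  funext t
  simp [onePerfectBeliefs, sureReport]

theorem accuracy_onePerfectBeliefs {n m : ℕ} (hm : 0 < m) (i : Fin n) :
    accuracy (onePerfectBeliefs n m) (fun _ => 1) i = if i.val = 0 then 1 else 0 := by
  have : (m : ℝ) ≠ 0 := by exact_mod_cast hm.ne'
  by_cases h : i.val = 0 <;> simp [accuracy, onePerfectBeliefs, h, this]

theorem elfPointProb_onePerfectBeliefs {n m : ℕ} (hn : 2 ≤ n) (t : Fin m) (i : Fin n) :
    elfPointProb (onePerfectBeliefs n m) (fun _ => true) t i =
      if i.val = 0 then 2 / (n : ℝ) else ((n : ℝ) - 2) / (n * (n - 1)) := by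
  have hq : ∀ j : Fin n, quadScore (onePerfectBeliefs n m j t) true =
      if j = ⟨0, by omega⟩ then 1 else 0 := fun j => by
    by_cases h : j.val = 0 <;> simp [quadScore, onePerfectBeliefs, outcomeValue, h, Fin.ext_iff]
  have hn2 : (2 : ℝ) ≤ n := by exact_mod_cast hn
  have h1 : (n : ℝ) - 1 ≠ 0 := by linarith
  have h2 : (n : ℝ) ≠ 0 := by linarith
  unfold elfPointProb
  rw [if_neg (by omega)]
  simp only [hq, Finset.sum_ite_eq', Finset.mem_erase, Finset.mem_univ, and_true]
  by_cases h : i.val = 0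
  · simp [Fin.ext_iff, h]
    ring
  · simp [Fin.ext_iff, h, eq_comm]
    field_simp
    ring

theorem sum_sq_elfPointProb_onePerfectBeliefs {n m : ℕ} (hn : 2 ≤ n) (t : Fin m) :
    ∑ i, elfPointProb (onePerfectBeliefs n m) (fun _ => true) t i ^ 2 = 1 / ((n : ℝ) - 1) := by
  simp only [elfPointProb_onePerfectBeliefs hn]
  obtain ⟨k, rfl⟩ := Nat.exists_eq_add_of_le' hn
  rw [Fin.sum_univ_succ]
  have h1 : (k : ℝ) + 1 ≠ 0 := by positivity
  have h2 : (k : ℝ) + 2 ≠ 0 := by positivity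
  have h3 : (k : ℝ) + 2 - 1 = k + 1 := by ring
  simp [h3]
  field_simp
  ring

theorem sq_elfProb_onePerfectBeliefs_le {n m : ℕ} (hn : 2 ≤ n) (hm : 0 < m) (i : Fin n) :
    elfProb n m (onePerfectBeliefs n m) (fun _ => true) i ^ 2 ≤ (n / ((n : ℝ) - 1)) ^ m / n := by
  -- All events have the same lottery, so event `0` represents them.
  have h := sq_sum_prod_mul_tieBreak_le (m := m)
    (elfPointProb (onePerfectBeliefs n m) (fun _ => true) ⟨0, hm⟩) i
  rw [sum_sq_elfPointProb_onePerfectBeliefs hn, mul_one_div] at h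
  exact h

theorem elfProb_onePerfectBeliefs_le_half {n m : ℕ} (hn : 16 ≤ n) (hm : 0 < m)
    (hmn : (m : ℝ) ≤ (n : ℝ) / 4 * Real.log n) (i : Fin n) :
    elfProb n m (onePerfectBeliefs n m) (fun _ => true) i ≤ 1 / 2 := by
  have hn16 : (16 : ℝ) ≤ n := by exact_mod_cast hn
  have hn1 : (0 : ℝ) < (n : ℝ) - 1 := by linarith
  have hlog : 0 ≤ Real.log n := Real.log_natCast_nonneg n
  -- `s` is `√n`; the threshold `16` makes `s ≥ 4`.
  set s := Real.exp (Real.log n / 2) with hs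
  have hss : s * s = n := by
    rw [hs, ← Real.exp_add, add_halves, Real.exp_log (by linarith)]
  have hs0 : 0 < s := Real.exp_pos _
  have hs4 : 4 ≤ s := by nlinarith
  have hpow : ((n : ℝ) / (n - 1)) ^ m ≤ s := by
    have hbase : (n : ℝ) / (n - 1) ≤ Real.exp (1 / (n - 1)) := by
      have h := Real.add_one_le_exp (1 / ((n : ℝ) - 1))
      have he : (n : ℝ) / (n - 1) = 1 / (n - 1) + 1 := by
        field_simp
        ring
      rwa [he]
    calc ((n : ℝ) / (n - 1)) ^ m ≤ Real.exp (1 / (n - 1)) ^ m := by gcongr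
      _ = Real.exp (m / (n - 1)) := by rw [← Real.exp_nat_mul, mul_one_div]
      _ ≤ s := by
        refine Real.exp_le_exp.2 ((div_le_iff₀ hn1).2 (hmn.trans ?_))
        -- Uses `n ≤ 2(n - 1)`.
        nlinarith
  have hsq : elfProb n m (onePerfectBeliefs n m) (fun _ => true) i ^ 2 ≤ (1 / 2) ^ 2 := by
    refine (sq_elfProb_onePerfectBeliefs_le (by omega) hm i).trans ?_
    rw [div_le_iff₀ (by linarith)]
    -- Amounts to `s / n = 1 / s ≤ 1 / 4`.
    nlinarith
  exact le_of_sq_le_sq hsq (by norm_num)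

theorem elf_successProb_onePerfectBeliefs_le_half {n m : ℕ} {ε : ℝ} (hε : ε < 1) (hn : 16 ≤ n)
    (hm : 0 < m) (hmn : (m : ℝ) ≤ (n : ℝ) / 4 * Real.log n) :
    elf.successProb ε (onePerfectBeliefs n m) (fun _ => 1) (onePerfectBeliefs n m) ≤ 1 / 2 := by
  have hθ : (fun _ : Fin m => (1 : unitInterval)) = sureReport m true := rfl
  have hopt : ∀ i : Fin n, IsOptimal ε (onePerfectBeliefs n m) (fun _ => 1) i → i.val = 0 :=
    fun i hi => by
      by_contra h0
      have h := hi ⟨0, by omega⟩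
      rw [accuracy_onePerfectBeliefs hm, accuracy_onePerfectBeliefs hm, if_pos rfl,
        if_neg h0] at h
      linarith
  unfold Mechanism.successProb
  simp only [hθ, outcomeProb_sureReport, ite_mul, one_mul, zero_mul, Finset.sum_ite_eq',
    Finset.mem_univ, if_true]
  rw [Finset.sum_eq_single (⟨0, by omega⟩ : Fin n)]
  · have h := elfProb_onePerfectBeliefs_le_half hn hm hmn ⟨0, by omega⟩
    -- For `ε < 0` nobody is `ε`-optimal, and the success probability is `0`.
    split_ifs
    · exact h
    · norm_num
  · intro i _ hi
    rw [if_neg fun h => hi (Fin.ext (hopt i h))]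
  · simp

theorem elf_not_isAccurate_onePerfectBeliefs {n m : ℕ} {ε δ : ℝ} (hε : ε < 1) (hδ : δ < 1 / 2)
    (hn : 16 ≤ n) (hm : 0 < m) (hmn : (m : ℝ) ≤ (n : ℝ) / 4 * Real.log n) :
    ¬ elf.IsAccurate ε δ (onePerfectBeliefs n m) (fun _ => 1) := by
  intro h
  have h1 := h (onePerfectBeliefs n m) fun i => by
    rw [onePerfectBeliefs_eq_sureReport]
    exact elf_undominated_sureReport i _
  have h2 := elf_successProb_onePerfectBeliefs_le_half hε hn hm hmn
  linarith

/-! ### From failing settings to event complexity -/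

theorem lt_eventComplexity (M : Mechanism) {n : ℕ} {ε δ x : ℝ} (hx : 0 ≤ x)
    (h : ∀ m : ℕ, 0 < m → (m : ℝ) ≤ x →
      ∃ (P : Reports n m) (θ : Fin m → unitInterval), ¬ M.IsAccurate ε δ P θ) :
    (x : EReal) < (((M.eventComplexity n ε δ : ℕ∞) : ENNReal) : EReal) := by
  have hle : ((⌊x⌋₊ + 1 : ℕ) : ℕ∞) ≤ M.eventComplexity n ε δ := by
    refine le_iInf fun m => le_iInf fun hm => ?_
    rw [Nat.cast_le, Nat.succ_le_iff]
    by_contra hlt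
    obtain ⟨P, θ, hP⟩ := h m hm.1 ((Nat.le_floor_iff hx).1 (not_lt.1 hlt))
    exact hP (hm.2 P θ)
  have hlt : (x : EReal) < ((((⌊x⌋₊ + 1 : ℕ) : ℕ∞) : ENNReal) : EReal) := by
    have hc : (((⌊x⌋₊ + 1 : ℕ) : ENNReal) : EReal) = (((⌊x⌋₊ + 1 : ℕ) : ℝ) : EReal) := rfl
    rw [ENat.toENNReal_coe, hc, EReal.coe_lt_coe_iff]
    exact_mod_cast Nat.lt_floor_add_one x
  refine hlt.trans_le ?_
  exact EReal.coe_ennreal_le_coe_ennreal_iff.2 (ENat.toENNReal_le.2 hle)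

end ForecastingCompetition

theorem mainTheorem6 (ε δ : ℝ) (hε : ε < 1) (hδ : δ < 1 / 2) :
    ∀ᶠ n : ℕ in Filter.atTop,
      (((n : ℝ) / 4 * Real.log n : ℝ) : EReal) <
          (((ForecastingCompetition.elf.eventComplexity n ε δ : ℕ∞) : ENNReal) : EReal) ∧
      ∀ m : ℕ, 0 < m → (m : ℝ) ≤ (n : ℝ) / 4 * Real.log n →
        ¬ ForecastingCompetition.elf.IsAccurate ε δ
          (ForecastingCompetition.onePerfectBeliefs n m) (fun _ => 1) := by
  filter_upwards [Filter.eventually_ge_atTop 16] with n hn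
  have h : ∀ m : ℕ, 0 < m → (m : ℝ) ≤ (n : ℝ) / 4 * Real.log n →
      ¬ ForecastingCompetition.elf.IsAccurate ε δ
        (ForecastingCompetition.onePerfectBeliefs n m) (fun _ => 1) := fun m hm hmn =>
    ForecastingCompetition.elf_not_isAccurate_onePerfectBeliefs hε hδ hn hm hmn
  exact ⟨ForecastingCompetition.lt_eventComplexity _
    (mul_nonneg (by positivity) (Real.log_natCast_nonneg n)) fun m hm hmn => ⟨_, _, h m hm hmn⟩, h⟩
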